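/- Let $d\ge 1$, let $S^{d-1}$ be the unit sphere of $\mathbf R^d$ with its normalized surface measure $d\omega$, and for $(\omega,p)\in S^{d-1}\times\mathbf R$ put $H_{\omega,p}=\{x\in\mathbf R^d : x\cdot\omega<p\}$; the closed halfspace $\overline{H_{\omega,p}}$ is contained in $\mathbf R^d\setminus\{0\}$ exactly when $p<0$. Let $\beta>0$ be a real number that is not an integer, and let $a(\omega,p)$ be a locally bounded real function on $S^{d-1}\times(-\infty,0)$ that is homogeneous of degree $-\beta$ in $p$: $a(\omega,rp)=r^{-\beta}a(\omega,p)$ for all $\omega\in S^{d-1}$, $p<0$, $r>0$. Then there is at most one non-negative Radon measure $\mu$ on $\mathbf R^d\setminus\{0\}$, with finite mass on every set whose closure in $\mathbf R^d$ does not contain the origin, such that $$\mu(H_{\omega,p})=a(\omega,p)\quad\text{for almost all }(\omega,p)\in S^{d-1}\times(-\infty,0)$$ (with respect to $d\omega\,dp$). Moreover, if such a measure $\mu$ exists, then: (i) $\mu$ is homogeneous of degree $-d-\beta$, that is, $\int\varphi(x/r)\,d\mu(x)=r^{-\beta}\int\varphi\,d\mu$ for all $r>0$ and all $C^\infty$ functions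 $\varphi$ with compact support in $\mathbf R^d\setminus\{0\}$; (ii) $R\mu=\partial_p a$ on $S^{d-1}\times(-\infty,0)$, where $R\mu$ is the Radon transform of $\mu$, defined by $\langle R\mu,\psi\rangle=\int R^*\psi\,d\mu$ with $R^*\psi(x)=\int_{S^{d-1}}\psi(\omega,x\cdot\omega)\,d\omega$; that is, $\partial_p a(\omega,p)$ exists for all $\omega\in S^{d-1}$ and $p<0$, and for every continuous function $\psi$ with compact support in $S^{d-1}\times(-\infty,0)$ (extended by zero to $S^{d-1}\times\mathbf R$) the following integrals converge absolutely and $$\int_{\mathbf R^d\setminus\{0\}}\int_{S^{d-1}}\psi(\omega,x\cdot\omega)\,d\omega\,d\mu(x)=\int_{S^{d-1}}\int_{-\infty}^0\partial_p a(\omega,p)\,\psi(\omega,p)\,dp\,d\omega .$$ -/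

import Mathlib

open MeasureTheory
open scoped CompactlySupported

noncomputable section

namespace CramerWold

/-- The space `ℝ^d`, with its Euclidean norm and inner product. -/
abbrev Space (d : ℕ) : Type := EuclideanSpace ℝ (Fin d)

/-- The punctured space `ℝ^d ∖ {0}`. -/
abbrev Punctured (d : ℕ) : Type := {x : Space d // x ≠ 0}

/-- The unit sphere `S^{d-1}` of `ℝ^d`. -/
abbrev UnitSphere (d : ℕ) : Type := Metric.sphere (0 : Space d) 1

/-- The normalized surface measure `dω` on `S^{d-1}`. -/
def sphereMeasure (d : ℕ) : Measure (UnitSphere d) :=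
  ((volume : Measure (Space d)).toSphere Set.univ)⁻¹ • (volume : Measure (Space d)).toSphere

/-- The measure `dp dω` on `S^{d-1} × {p < 0}`, seen as a measure on `S^{d-1} × ℝ`. -/
def negMeasure (d : ℕ) : Measure (UnitSphere d × ℝ) :=
  (sphereMeasure d).prod (volume.restrict (Set.Iio 0))

/-- The halfspace `H_{ω,p} = {x | x · ω < p}`, without the origin. For `p < 0`, the only case
in which it is used, the origin does not belong to the closure of `{x ∈ ℝ^d | x · ω < p}`. -/
def halfspace {d : ℕ} (ω : UnitSphere d) (p : ℝ) : Set (Punctured d) :=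
  {x | inner ℝ (x : Space d) (ω : Space d) < p}

/-- `a` is locally bounded on `S^{d-1} × {p < 0}`. -/
def LocallyBoundedNeg {d : ℕ} (a : UnitSphere d → ℝ → ℝ) : Prop :=
  ∀ (ω : UnitSphere d) (p : ℝ), p < 0 →
    ∃ C : ℝ, ∀ᶠ z : UnitSphere d × ℝ in nhds (ω, p), |a z.1 z.2| ≤ C

/-- `a` is homogeneous of degree `γ` in the variable `p < 0`, for every `ω`. -/
def HomogeneousInP {d : ℕ} (a : UnitSphere d → ℝ → ℝ) (γ : ℝ) : Prop :=
  ∀ (ω : UnitSphere d) (p r : ℝ), p < 0 → 0 < r → a ω (r * p) = r ^ γ * a ω p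

/-- The non-negative measure `μ` on `ℝ^d ∖ {0}` is a Radon measure, it has finite mass on sets
bounded away from the origin, and `μ (H_{ω,p}) = a (ω, p)` for almost all `(ω, p)` with
`p < 0`. -/
structure Represents {d : ℕ} (μ : Measure (Punctured d)) (a : UnitSphere d → ℝ → ℝ) : Prop where
  radon : IsFiniteMeasureOnCompacts μ
  finite_away : ∀ A : Set (Punctured d),
    (0 : Space d) ∉ closure ((fun x : Punctured d => (x : Space d)) '' A) → μ A < ⊤
  halfspace_eq : ∀ᵐ z ∂(negMeasure d), μ.real (halfspace z.1 z.2) = a z.1 z.2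

/-- The measure `μ` on `ℝ^d ∖ {0}` is homogeneous of degree `α`:
`⟨μ, φ(·/r)⟩ = r^(d+α) ⟨μ, φ⟩` for all `r > 0` and all smooth `φ` with compact support
in `ℝ^d ∖ {0}`. -/
def HomogeneousMeasure {d : ℕ} (μ : Measure (Punctured d)) (α : ℝ) : Prop :=
  ∀ φ : Space d → ℝ, ContDiff ℝ (⊤ : ℕ∞) φ → HasCompactSupport φ → (0 : Space d) ∉ tsupport φ →
    ∀ r : ℝ, 0 < r →
      ∫ x, φ (r⁻¹ • (x : Space d)) ∂μ = r ^ ((d : ℝ) + α) * ∫ x, φ (x : Space d) ∂μ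

/-- The test functions on `S^{d-1} × {p < 0}`: continuous functions with compact support. -/
abbrev NegTest (d : ℕ) : Type := C_c(UnitSphere d × Set.Iio (0 : ℝ), ℝ)

/-- A test function on `S^{d-1} × {p < 0}`, extended by zero to `S^{d-1} × ℝ`. -/
def extendZero {d : ℕ} (ψ : NegTest d) (ω : UnitSphere d) (p : ℝ) : ℝ :=
  if h : p < 0 then ψ (ω, ⟨p, h⟩) else 0

/-- The dual Radon transform `R^*ψ (x) = ∫ ψ (ω, x · ω) dω`. -/
def dualRadon {d : ℕ} (ψ : NegTest d) (x : Punctured d) : ℝ :=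
  ∫ ω, extendZero ψ ω (inner ℝ (x : Space d) (ω : Space d)) ∂(sphereMeasure d)

/-- The Radon transform of `μ` on `S^{d-1} × {p < 0}`, as a linear form on test functions:
`⟨Rμ, ψ⟩ = ⟨μ, R^*ψ⟩`. -/
def radonTransform {d : ℕ} (μ : Measure (Punctured d)) (ψ : NegTest d) : ℝ :=
  ∫ x, dualRadon ψ x ∂μ

/-- `Rμ = ∂_p a` on `S^{d-1} × {p < 0}`: the derivative `∂_p a` exists there, `Rμ` is defined
on every test function, and `Rμ` is the measure with the density `∂_p a`. -/
def RadonEqDerivP {d : ℕ} (μ : Measure (Punctured d)) (a : UnitSphere d → ℝ → ℝ) : Prop :=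
  (∀ (ω : UnitSphere d) (p : ℝ), p < 0 → DifferentiableAt ℝ (a ω) p) ∧
  ∀ ψ : NegTest d,
    Integrable (dualRadon ψ) μ ∧
    Integrable (fun z : UnitSphere d × ℝ => deriv (a z.1) z.2 * extendZero ψ z.1 z.2)
      (negMeasure d) ∧
    radonTransform μ ψ = ∫ z, deriv (a z.1) z.2 * extendZero ψ z.1 z.2 ∂(negMeasure d)

end CramerWold

end

open CramerWold

open CramerWold

noncomputable section

open Set Filter Topology
open scoped ENNReal

namespace CramerWold

variable {d : ℕ}

/-! Halfspace masses fix the images of `μ` under the maps `x ↦ x · ω` away from zero. Since `μ` and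
its rescalings all represent `a`, they have equal halfspace masses in every direction
(`Represents.measure_halfspace_eq`), so each image is a pair of power laws with coefficients `c ω`
and `c (-ω)` (`HomTails.map_eq`). Let `m < β < m + 1`. A function with a zero of order `m + 1` and
growth of order `m` is integrable against these laws, so `∫ f (x · ξ) dμ` depends on `c` alone
(`HomTails.integral_inner_eq`). This applies to the Taylor remainder of degree `m` of `exp (I t)`. A
finite difference of order `2 (m + 1)` kills the Taylor polynomial, so `c` also determines the
integrals of `exp (I x · ξ) |exp (I x · h) - 1| ^ (2 (m + 1))`: these form the Fourier transform of
a finite measure (`HomTails.withDensity_eq`). Varying `h` and dividing by the weight recovers `μ`.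
Uniqueness, applied to `μ` and its rescalings, gives (i). Fubini and the power laws give (ii). -/

/-! ### Halfspace masses, from almost all to all directions. -/

lemma isOpen_halfspace (ω : UnitSphere d) (p : ℝ) : IsOpen (halfspace ω p) :=
  isOpen_lt (by fun_prop) continuous_const

lemma measurableSet_halfspace (ω : UnitSphere d) (p : ℝ) : MeasurableSet (halfspace ω p) :=
  (isOpen_halfspace ω p).measurableSet

lemma halfspace_mono (ω : UnitSphere d) : Monotone (halfspace ω) :=
  fun _ _ hpq _ hx ↦ lt_of_lt_of_le hx hpq

lemma norm_gt_of_mem_halfspace {ω : UnitSphere d} {p : ℝ} {x : Punctured d}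
    (hx : x ∈ halfspace ω p) : -p < ‖(x : Space d)‖ := by
  have h := abs_real_inner_le_norm (x : Space d) (ω : Space d)
  have hω : ‖(ω : Space d)‖ = 1 := by simp
  rw [hω, mul_one] at h
  have hx' : inner ℝ (x : Space d) (ω : Space d) < p := hx
  linarith [neg_abs_le (inner ℝ (x : Space d) (ω : Space d))]

/-- The measure `μ` has finite mass outside every ball around the origin. -/
def FiniteAway (μ : Measure (Punctured d)) : Prop :=
  ∀ r : ℝ, 0 < r → μ {x | r ≤ ‖(x : Space d)‖} < ⊤

lemma Represents.finiteAway {μ : Measure (Punctured d)} {a : UnitSphere d → ℝ → ℝ}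
    (h : Represents μ a) : FiniteAway μ := by
  intro r hr
  apply h.finite_away
  intro h0
  have hc : IsClosed {x : Space d | r ≤ ‖x‖} := isClosed_le continuous_const continuous_norm
  have := closure_minimal (t := {x : Space d | r ≤ ‖x‖})
    (by rintro _ ⟨x, hx, rfl⟩; exact hx) hc h0
  simp at this
  linarith

lemma FiniteAway.halfspace_lt_top {μ : Measure (Punctured d)} (h : FiniteAway μ)
    (ω : UnitSphere d) {p : ℝ} (hp : p < 0) : μ (halfspace ω p) < ⊤ :=
  (measure_mono fun _ hx ↦ (norm_gt_of_mem_halfspace hx).le).trans_lt (h (-p) (by linarith))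

lemma iUnion_halfspace (ω : UnitSphere d) {p : ℝ} {u : ℕ → ℝ} (hu : ∀ n, u n < p)
    (hlim : Tendsto u atTop (𝓝 p)) : ⋃ n, halfspace ω (u n) = halfspace ω p := by
  apply Subset.antisymm
  · exact iUnion_subset fun n ↦ halfspace_mono ω (hu n).le
  · intro x hx
    obtain ⟨n, hn⟩ := (hlim.eventually (lt_mem_nhds hx)).exists
    exact mem_iUnion.2 ⟨n, hn⟩

lemma tendsto_measure_halfspace (μ : Measure (Punctured d)) (ω : UnitSphere d) {p : ℝ}
    {u : ℕ → ℝ} (hm : Monotone u) (hu : ∀ n, u n < p) (hlim : Tendsto u atTop (𝓝 p)) :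
    Tendsto (fun n ↦ μ (halfspace ω (u n))) atTop (𝓝 (μ (halfspace ω p))) := by
  rw [← iUnion_halfspace ω hu hlim]
  exact tendsto_measure_iUnion_atTop ((halfspace_mono ω).comp hm)

lemma FiniteAway.tendsto_measure_compl_ball {μ : Measure (Punctured d)} (h : FiniteAway μ) :
    Tendsto (fun n : ℕ ↦ μ {x | (n : ℝ) ≤ ‖(x : Space d)‖}) atTop (𝓝 0) := by
  have hmeas (n : ℕ) : MeasurableSet {x : Punctured d | (n : ℝ) ≤ ‖(x : Space d)‖} :=
    (isClosed_le continuous_const (by fun_prop)).measurableSet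
  have := tendsto_measure_iInter_atTop (μ := μ) (fun n ↦ (hmeas n).nullMeasurableSet)
    (fun m n hmn x hx ↦ (Nat.cast_le.2 hmn : (m : ℝ) ≤ n).trans hx) ⟨1, by
      have := h 1 one_pos
      simpa using this.ne⟩
  have hempty : ⋂ n : ℕ, {x : Punctured d | (n : ℝ) ≤ ‖(x : Space d)‖} = ∅ := by
    rw [eq_empty_iff_forall_notMem]
    intro x hx
    obtain ⟨n, hn⟩ := exists_nat_gt ‖(x : Space d)‖
    exact absurd (mem_iInter.1 hx n) (not_le.2 hn)
  rwa [hempty, measure_empty] at this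

/-- Rotating `ω` to `ω'` changes `x · ω` by at most `‖x‖ * dist ω ω'`, which is controlled only
inside a ball. -/
lemma halfspace_subset_of_dist {ω ω' : UnitSphere d} {p q R : ℝ}
    (h : dist ω ω' * R ≤ q - p) :
    halfspace ω p ⊆ halfspace ω' q ∪ {x | R ≤ ‖(x : Space d)‖} := by
  intro x hx
  rw [mem_union, or_iff_not_imp_right]
  intro hR
  simp only [mem_ofPred_eq, not_le] at hR
  have hx' : inner ℝ (x : Space d) (ω : Space d) < p := hx
  have h1 : inner ℝ (x : Space d) ((ω' : Space d) - ω) ≤ ‖(x : Space d)‖ * dist ω ω' := by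
    refine (real_inner_le_norm _ _).trans_eq ?_
    rw [← dist_eq_norm, dist_comm, Subtype.dist_eq]
  rw [inner_sub_right] at h1
  have h2 : ‖(x : Space d)‖ * dist ω ω' ≤ R * dist ω ω' := by gcongr
  change inner ℝ (x : Space d) (ω' : Space d) < q
  linarith

/-- An inequality between the masses of halfspaces extends from a dense set of directions
to all directions. -/
lemma measure_halfspace_le_of_dense {μ ν : Measure (Punctured d)} (hμ : FiniteAway μ)
    (hν : FiniteAway ν) {D : Set (UnitSphere d)} (hD : Dense D)
    (h : ∀ ω ∈ D, ∀ p < 0, μ (halfspace ω p) ≤ ν (halfspace ω p))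
    (ω : UnitSphere d) (p : ℝ) (hp : p < 0) : μ (halfspace ω p) ≤ ν (halfspace ω p) := by
  -- The gap `p - p'` pays for rotating `ω` to a direction in `D` and back, half of it each way; the
  -- errors outside the ball of radius `n` vanish in the limit.
  have key : ∀ p' < p, μ (halfspace ω p') ≤ ν (halfspace ω p) := by
    intro p' hp'
    have bound : ∀ n : ℕ, μ (halfspace ω p') ≤ ν (halfspace ω p)
        + ν {x | (n : ℝ) ≤ ‖(x : Space d)‖} + μ {x | (n : ℝ) ≤ ‖(x : Space d)‖} := by
      intro n
      obtain ⟨ω', hω', hdist⟩ := hD.exists_dist_lt ω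
        (ε := (p - p') / (2 * (n + 1))) (by have := sub_pos.2 hp'; positivity)
      have hle : dist ω ω' * n ≤ (p - p') / 2 := by
        have h1 : dist ω ω' * (n + 1) ≤ (p - p') / 2 := by
          have := mul_le_mul_of_nonneg_right hdist.le (by positivity : (0 : ℝ) ≤ n + 1)
          refine this.trans_eq ?_
          field_simp
        have := dist_nonneg (x := ω) (y := ω')
        linarith
      have hs1 := halfspace_subset_of_dist (ω := ω) (ω' := ω') (p := p') (q := (p + p') / 2)
        (R := n) (by linarith [hle])
      have hs2 := halfspace_subset_of_dist (ω := ω') (ω' := ω) (p := (p + p') / 2) (q := p)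
        (R := n) (by rw [dist_comm]; linarith)
      calc μ (halfspace ω p')
          ≤ μ (halfspace ω' ((p + p') / 2)) + μ {x | (n : ℝ) ≤ ‖(x : Space d)‖} :=
            (measure_mono hs1).trans (measure_union_le _ _)
        _ ≤ ν (halfspace ω' ((p + p') / 2)) + μ {x | (n : ℝ) ≤ ‖(x : Space d)‖} := by
            have := h ω' hω' ((p + p') / 2) (by linarith)
            gcongr
        _ ≤ _ := by gcongr; exact (measure_mono hs2).trans (measure_union_le _ _)
    have hlim := (tendsto_const_nhds (x := ν (halfspace ω p))).add
      hν.tendsto_measure_compl_ball |>.add hμ.tendsto_measure_compl_ball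
    simp only [add_zero] at hlim
    exact ge_of_tendsto' hlim bound
  obtain ⟨u, hum, hup, hlim⟩ := exists_seq_strictMono_tendsto p
  exact le_of_tendsto' (tendsto_measure_halfspace μ ω hum.monotone hup hlim)
    fun n ↦ key _ (hup n)

instance : IsFiniteMeasure (sphereMeasure d) := by
  unfold sphereMeasure
  rcases eq_or_ne ((volume : Measure (Space d)).toSphere univ) 0 with h | h
  · rw [Measure.measure_univ_eq_zero.1 h]
    simp only [smul_zero]
    infer_instance
  · exact Measure.smul_finite _ (by simpa using h)

instance : (sphereMeasure d).IsOpenPosMeasure := by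
  unfold sphereMeasure
  exact Measure.isOpenPosMeasure_smul _ (ENNReal.inv_ne_zero.2 (measure_ne_top _ _))

lemma HomogeneousInP.eq_mul {a : UnitSphere d → ℝ → ℝ} {γ : ℝ} (ha : HomogeneousInP a γ)
    (ω : UnitSphere d) {p : ℝ} (hp : p < 0) : a ω p = a ω (-1) * (-p) ^ γ := by
  have := ha ω (-1) (-p) (by norm_num) (by linarith)
  rw [mul_comm, ← this]
  simp

/-- In almost every direction, the masses of all halfspaces are given by `a`. -/
lemma Represents.ae_forall {μ : Measure (Punctured d)} {a : UnitSphere d → ℝ → ℝ} {γ : ℝ}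
    (h : Represents μ a) (ha : HomogeneousInP a γ) :
    ∀ᵐ ω ∂(sphereMeasure d), ∀ p < 0, μ.real (halfspace ω p) = a ω p := by
  have h1 := Measure.ae_ae_of_ae_prod h.halfspace_eq
  filter_upwards [h1] with ω hω p hp
  rw [ae_restrict_iff' measurableSet_Iio] at hω
  have hd := Measure.dense_of_ae hω
  -- From below, the open halfspaces increase to `halfspace ω p`, so masses converge; homogeneity
  -- makes `a ω` continuous.
  obtain ⟨u, hum, hu, hlim⟩ := hd.exists_seq_strictMono_tendsto p
  have hup : ∀ n, u n < p := fun n ↦ (hu n).1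
  have hmem : ∀ n, μ.real (halfspace ω (u n)) = a ω (u n) :=
    fun n ↦ (hu n).2 (lt_trans (hup n) hp)
  have l1 : Tendsto (fun n ↦ μ.real (halfspace ω (u n))) atTop (𝓝 (μ.real (halfspace ω p))) :=
    (ENNReal.tendsto_toReal (h.finiteAway.halfspace_lt_top ω hp).ne).comp
      (tendsto_measure_halfspace μ ω hum.monotone hup hlim)
  have l2 : Tendsto (fun n ↦ a ω (u n)) atTop (𝓝 (a ω p)) := by
    rw [ha.eq_mul ω hp]
    have : ∀ n, a ω (u n) = a ω (-1) * (-(u n)) ^ γ := fun n ↦ ha.eq_mul ω ((hup n).trans hp)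
    simp_rw [this]
    exact tendsto_const_nhds.mul (hlim.neg.rpow_const (Or.inl (by linarith)))
  simp_rw [hmem] at l1
  exact tendsto_nhds_unique l1 l2

lemma Represents.measure_halfspace_eq {μ ν : Measure (Punctured d)} {a : UnitSphere d → ℝ → ℝ}
    {γ : ℝ} (hμ : Represents μ a) (hν : Represents ν a) (ha : HomogeneousInP a γ)
    (ω : UnitSphere d) (p : ℝ) (hp : p < 0) : μ (halfspace ω p) = ν (halfspace ω p) := by
  have hD : Dense {ω : UnitSphere d | ∀ p < 0, μ (halfspace ω p) = ν (halfspace ω p)} := by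
    apply Measure.dense_of_ae (μ := sphereMeasure d)
    filter_upwards [hμ.ae_forall ha, hν.ae_forall ha] with ω h1 h2 p hp
    rw [← ENNReal.toReal_eq_toReal_iff' (hμ.finiteAway.halfspace_lt_top ω hp).ne
      (hν.finiteAway.halfspace_lt_top ω hp).ne]
    exact (h1 p hp).trans (h2 p hp).symm
  exact le_antisymm
    (measure_halfspace_le_of_dense hμ.finiteAway hν.finiteAway hD (fun ω h p hp ↦ (h p hp).le)
      ω p hp)
    (measure_halfspace_le_of_dense hν.finiteAway hμ.finiteAway hD (fun ω h p hp ↦ (h p hp).ge)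
      ω p hp)

/-! ### Dilations and homogeneity of the halfspace masses. -/

/-- The dilation `x ↦ s • x` of the punctured space. -/
def dilation (s : ℝ) (hs : 0 < s) (x : Punctured d) : Punctured d :=
  ⟨s • (x : Space d), smul_ne_zero hs.ne' x.2⟩

lemma continuous_dilation (s : ℝ) (hs : 0 < s) : Continuous (dilation (d := d) s hs) := by
  unfold dilation; fun_prop

lemma dilation_preimage_halfspace (s : ℝ) (hs : 0 < s) (ω : UnitSphere d) (p : ℝ) :
    dilation s hs ⁻¹' halfspace ω p = halfspace ω (s⁻¹ * p) := by
  ext x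
  simp only [dilation, halfspace, mem_preimage, mem_ofPred_eq, real_inner_smul_left]
  rw [inv_mul_eq_div, lt_div_iff₀ hs, mul_comm]

lemma isFiniteMeasureOnCompacts_of_finiteAway {μ : Measure (Punctured d)} (h : FiniteAway μ) :
    IsFiniteMeasureOnCompacts μ := by
  refine ⟨fun K hK ↦ ?_⟩
  rcases K.eq_empty_or_nonempty with rfl | hne
  · simp
  obtain ⟨x, -, hx⟩ := hK.exists_isMinOn hne
    (f := fun x : Punctured d ↦ ‖(x : Space d)‖) (by fun_prop)
  exact (measure_mono fun y hy ↦ hx hy).trans_lt (h _ (norm_pos_iff.2 x.2))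

lemma finite_of_notMem_closure {μ : Measure (Punctured d)} (h : FiniteAway μ)
    {A : Set (Punctured d)}
    (hA : (0 : Space d) ∉ closure ((fun x : Punctured d => (x : Space d)) '' A)) : μ A < ⊤ := by
  rw [Metric.mem_closure_iff] at hA
  push Not at hA
  obtain ⟨ε, hε, hA⟩ := hA
  refine (measure_mono fun x hx ↦ ?_).trans_lt (h ε hε)
  simpa using hA x (mem_image_of_mem _ hx)

/-- The rescaled measure with the same masses of halfspaces. -/
def rescale (μ : Measure (Punctured d)) (β s : ℝ) (hs : 0 < s) : Measure (Punctured d) :=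
  ENNReal.ofReal (s ^ (-β)) • μ.map (dilation s hs)

lemma rescale_halfspace (μ : Measure (Punctured d)) (β s : ℝ) (hs : 0 < s) (ω : UnitSphere d)
    (p : ℝ) : rescale μ β s hs (halfspace ω p)
      = ENNReal.ofReal (s ^ (-β)) * μ (halfspace ω (s⁻¹ * p)) := by
  rw [rescale, Measure.smul_apply, smul_eq_mul,
    Measure.map_apply (continuous_dilation s hs).measurable (measurableSet_halfspace ω p),
    dilation_preimage_halfspace]

lemma Represents.rescale {μ : Measure (Punctured d)} {a : UnitSphere d → ℝ → ℝ} {β : ℝ}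
    (h : Represents μ a) (ha : HomogeneousInP a (-β)) (s : ℝ) (hs : 0 < s) :
    Represents (rescale μ β s hs) a := by
  have hfin : FiniteAway (CramerWold.rescale μ β s hs) := by
    intro r hr
    rw [CramerWold.rescale, Measure.smul_apply, smul_eq_mul,
      Measure.map_apply (continuous_dilation s hs).measurable
        (isClosed_le continuous_const (by fun_prop)).measurableSet]
    refine ENNReal.mul_lt_top ENNReal.ofReal_lt_top ?_
    refine (measure_mono fun x hx ↦ ?_).trans_lt (h.finiteAway (s⁻¹ * r) (by positivity))
    simp only [dilation, mem_preimage, mem_ofPred_eq, norm_smul, Real.norm_eq_abs,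
      abs_of_pos hs] at hx ⊢
    rw [inv_mul_eq_div, div_le_iff₀ hs, mul_comm]
    exact hx
  refine ⟨isFiniteMeasureOnCompacts_of_finiteAway hfin,
    fun A hA ↦ finite_of_notMem_closure hfin hA, ?_⟩
  have h1 := (Measure.quasiMeasurePreserving_fst (μ := sphereMeasure d)
    (ν := volume.restrict (Iio (0 : ℝ)))).ae (h.ae_forall ha)
  have h2 := (Measure.quasiMeasurePreserving_snd (μ := sphereMeasure d)
    (ν := volume.restrict (Iio (0 : ℝ)))).ae (ae_restrict_mem measurableSet_Iio)
  filter_upwards [h1, h2] with z hz hp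
  have hp : z.2 < 0 := hp
  have hp' : s⁻¹ * z.2 < 0 := mul_neg_of_pos_of_neg (by positivity) hp
  rw [measureReal_def, rescale_halfspace, ENNReal.toReal_mul, ENNReal.toReal_ofReal (by positivity),
    ← measureReal_def, hz _ hp', ha _ _ _ hp (by positivity), Real.inv_rpow hs.le, ← mul_assoc,
    mul_inv_cancel₀ (by positivity), one_mul]

/-- Valid in every direction, including those where `a` differs from the masses: `μ` is compared
with its rescaling by `-p`, which moves the level `p` to `-1`. -/
lemma Represents.halfspace_homogeneous {μ : Measure (Punctured d)} {a : UnitSphere d → ℝ → ℝ}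
    {β : ℝ} (h : Represents μ a) (ha : HomogeneousInP a (-β)) (ω : UnitSphere d) {p : ℝ}
    (hp : p < 0) :
    μ (halfspace ω p) = μ (halfspace ω (-1)) * ENNReal.ofReal ((-p) ^ (-β)) := by
  have := h.measure_halfspace_eq (h.rescale ha (-p) (by linarith)) ha ω p hp
  rw [this, rescale_halfspace, mul_comm]
  rw [inv_neg, neg_mul, inv_mul_cancel₀ hp.ne]

/-! ### One-dimensional images of `μ`. -/

/-- The measure on `(0, ∞)` whose tails are `r ^ (-β)`. -/
def paretoTail (β : ℝ) : Measure ℝ :=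
  (volume.restrict (Ioi (0 : ℝ))).withDensity fun t ↦ ENNReal.ofReal (β * t ^ (-β - 1))

lemma paretoTail_Ioi {β : ℝ} (hβ : 0 < β) {r : ℝ} (hr : 0 < r) :
    paretoTail β (Ioi r) = ENNReal.ofReal (r ^ (-β)) := by
  rw [paretoTail, withDensity_apply _ measurableSet_Ioi, Measure.restrict_restrict measurableSet_Ioi,
    inter_eq_left.2 (Ioi_subset_Ioi hr.le), ← ofReal_integral_eq_lintegral_ofReal]
  · rw [integral_const_mul, integral_Ioi_rpow_of_lt (by linarith) hr]
    congr 1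
    rw [sub_add_cancel]
    field_simp
  · exact (integrableOn_Ioi_rpow_of_lt (by linarith) hr).const_mul β
  · refine (ae_restrict_iff' measurableSet_Ioi).2 (ae_of_all _ fun t ht ↦ ?_)
    have : 0 < t := hr.trans ht
    simp only [Pi.zero_apply]
    positivity

lemma paretoTail_Iic (β : ℝ) : paretoTail β (Iic 0) = 0 := by
  refine withDensity_absolutelyContinuous _ _ ?_
  rw [Measure.restrict_apply measurableSet_Iic, Iic_inter_Ioi, Ioc_self, measure_empty]

/-- Measures on `(0, ∞)` are determined by their tails. -/
lemma measure_ext_of_Ioi {ρ τ : Measure ℝ} (hρ : ρ (Iic 0) = 0) (hτ : τ (Iic 0) = 0)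
    (hfin : ∀ r, 0 < r → ρ (Ioi r) ≠ ⊤) (h : ∀ r, 0 < r → ρ (Ioi r) = τ (Ioi r)) : ρ = τ := by
  have h1 : ∀ n : ℕ, ρ.restrict (Ioi (1 / (n + 1 : ℝ))) = τ.restrict (Ioi (1 / (n + 1 : ℝ))) := by
    intro n
    have hn : (0 : ℝ) < 1 / (n + 1 : ℝ) := by positivity
    have : IsFiniteMeasure (ρ.restrict (Ioi (1 / (n + 1 : ℝ)))) :=
      ⟨by simpa using (hfin _ hn).lt_top⟩
    refine ext_of_generate_finite (range Ioi)
      (BorelSpace.measurable_eq.trans (borel_eq_generateFrom_Ioi ℝ)) isPiSystem_Ioi ?_ ?_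
    · rintro _ ⟨r, rfl⟩
      rw [Measure.restrict_apply measurableSet_Ioi, Measure.restrict_apply measurableSet_Ioi,
        Ioi_inter_Ioi]
      exact h _ (lt_max_of_lt_right hn)
    · simpa using h _ hn
  have hU : ⋃ n : ℕ, Ioi (1 / (n + 1 : ℝ)) = Ioi (0 : ℝ) := by
    ext t
    simp only [mem_iUnion, mem_Ioi]
    refine ⟨fun ⟨n, hn⟩ ↦ lt_trans (by positivity) hn, fun ht ↦ exists_nat_one_div_lt ht⟩
  have h2 := Measure.restrict_iUnion_congr.2 h1
  rw [hU, Measure.restrict_eq_self_of_ae_mem, Measure.restrict_eq_self_of_ae_mem] at h2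
  · exact h2
  · rw [ae_iff]; convert hτ using 2; ext; simp
  · rw [ae_iff]; convert hρ using 2; ext; simp

/-- The tails of `μ` are homogeneous of degree `-β`, with coefficient `c ω` in the direction
`ω`. -/
structure HomTails (μ : Measure (Punctured d)) (c : UnitSphere d → ℝ≥0∞) (β : ℝ) : Prop where
  lt_top : ∀ ω, c ω ≠ ⊤
  eq : ∀ ω p, p < 0 → μ (halfspace ω p) = c ω * ENNReal.ofReal ((-p) ^ (-β))

/-- The image of `μ` under `x ↦ -x · ω`, on the side where this is positive. -/
lemma HomTails.map_eq {μ : Measure (Punctured d)} {c : UnitSphere d → ℝ≥0∞} {β : ℝ} (hβ : 0 < β)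
    (h : HomTails μ c β) (ω : UnitSphere d) :
    (μ.restrict (halfspace ω 0)).map (fun x : Punctured d ↦ -inner ℝ (x : Space d) (ω : Space d))
      = c ω • paretoTail β := by
  have hm : Measurable fun x : Punctured d ↦ -inner ℝ (x : Space d) (ω : Space d) := by fun_prop
  have htail : ∀ r, 0 < r →
      (μ.restrict (halfspace ω 0)).map (fun x : Punctured d ↦ -inner ℝ (x : Space d) (ω : Space d)) (Ioi r)
        = c ω * ENNReal.ofReal (r ^ (-β)) := by
    intro r hr
    rw [Measure.map_apply hm measurableSet_Ioi, Measure.restrict_apply (hm measurableSet_Ioi)]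
    have := h.eq ω (-r) (by linarith)
    rw [neg_neg] at this
    rw [← this]
    congr 1
    ext x
    simp only [halfspace, mem_inter_iff, mem_preimage, mem_Ioi, mem_ofPred_eq]
    constructor
    · rintro ⟨h1, -⟩; linarith
    · intro h1; constructor <;> linarith
  refine measure_ext_of_Ioi ?_ ?_ ?_ ?_
  · rw [Measure.map_apply hm measurableSet_Iic, Measure.restrict_apply (hm measurableSet_Iic)]
    convert measure_empty (μ := μ)
    rw [eq_empty_iff_forall_notMem]
    rintro x ⟨h1, h2⟩
    simp only [halfspace, mem_preimage, mem_Iic, mem_ofPred_eq] at h1 h2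
    linarith
  · simp [paretoTail_Iic]
  · intro r hr
    rw [htail r hr]
    exact ENNReal.mul_ne_top (h.lt_top ω) ENNReal.ofReal_ne_top
  · intro r hr
    rw [htail r hr, Measure.smul_apply, smul_eq_mul, paretoTail_Ioi hβ hr]

variable {E : Type*} [NormedAddCommGroup E]

lemma HomTails.integrableOn_halfspace {μ : Measure (Punctured d)} {c : UnitSphere d → ℝ≥0∞}
    {β : ℝ} (hβ : 0 < β) (h : HomTails μ c β) (ω : UnitSphere d) {f : ℝ → E}
    (hf : Integrable (fun t ↦ f (-t)) (paretoTail β)) :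
    IntegrableOn (fun x : Punctured d ↦ f (inner ℝ (x : Space d) (ω : Space d)))
      (halfspace ω 0) μ := by
  have h1 : Integrable (fun t ↦ f (-t)) (c ω • paretoTail β) := hf.smul_measure (h.lt_top ω)
  rw [← h.map_eq hβ ω] at h1
  simpa [IntegrableOn, Function.comp_def] using (integrable_map_measure h1.1 (by fun_prop)).1 h1

variable [NormedSpace ℝ E]

lemma HomTails.setIntegral_halfspace {μ : Measure (Punctured d)} {c : UnitSphere d → ℝ≥0∞}
    {β : ℝ} (hβ : 0 < β) (h : HomTails μ c β) (ω : UnitSphere d) {f : ℝ → E}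
    (hf : AEStronglyMeasurable (fun t ↦ f (-t)) (paretoTail β)) :
    ∫ x in halfspace ω 0, f (inner ℝ (x : Space d) (ω : Space d)) ∂μ
      = (c ω).toReal • ∫ t, f (-t) ∂(paretoTail β) := by
  have h1 : AEStronglyMeasurable (fun t ↦ f (-t)) (c ω • paretoTail β) := hf.smul_measure _
  rw [← h.map_eq hβ ω] at h1
  have h2 := integral_map (by fun_prop) h1
  rw [h.map_eq hβ ω, integral_smul_measure] at h2
  simpa using h2.symm

lemma mem_halfspace_neg {ω : UnitSphere d} {x : Punctured d} :
    x ∈ halfspace (-ω) 0 ↔ 0 < inner ℝ (x : Space d) (ω : Space d) := by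
  simp [halfspace]

/-- The directions `ω` and `-ω` account for the two signs of `x · ω`. The condition `f 0 = 0`
disposes of the hyperplane `x · ω = 0`, whose mass may be infinite. -/
lemma HomTails.integral_inner {μ : Measure (Punctured d)} {c : UnitSphere d → ℝ≥0∞}
    {β : ℝ} (hβ : 0 < β) (h : HomTails μ c β) (ω : UnitSphere d) {f : ℝ → E} (h0 : f 0 = 0)
    (hf : Integrable f (paretoTail β)) (hf' : Integrable (fun t ↦ f (-t)) (paretoTail β)) :
    Integrable (fun x : Punctured d ↦ f (inner ℝ (x : Space d) (ω : Space d))) μ ∧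
    ∫ x, f (inner ℝ (x : Space d) (ω : Space d)) ∂μ
      = (c ω).toReal • ∫ t, f (-t) ∂(paretoTail β) + (c (-ω)).toReal • ∫ t, f t ∂(paretoTail β) := by
  have i1 := h.integrableOn_halfspace hβ ω hf'
  have i2 := h.integrableOn_halfspace hβ (-ω) (f := fun t ↦ f (-t)) (by simpa using hf)
  have e1 := h.setIntegral_halfspace hβ ω hf'.1
  have e2 := h.setIntegral_halfspace hβ (-ω) (f := fun t ↦ f (-t)) (by simpa using hf.1)
  simp only [coe_neg_sphere, inner_neg_right, neg_neg] at i2 e2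
  have hsupp : ∀ x : Punctured d, x ∉ halfspace ω 0 ∪ halfspace (-ω) 0 →
      f (inner ℝ (x : Space d) (ω : Space d)) = 0 := by
    intro x hx
    rw [mem_union, mem_halfspace_neg, not_or] at hx
    have h1 : ¬ inner ℝ (x : Space d) (ω : Space d) < 0 := hx.1
    rw [le_antisymm (not_lt.1 hx.2) (not_lt.1 h1), h0]
  have hdisj : Disjoint (halfspace ω 0) (halfspace (-ω) 0) := by
    rw [disjoint_left]
    intro x hx hx'
    rw [mem_halfspace_neg] at hx'
    exact lt_asymm hx hx'
  refine ⟨(integrableOn_iff_integrable_of_support_subset ?_).1 (i1.union i2), ?_⟩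
  · intro x hx
    by_contra hx'
    exact hx (hsupp x hx')
  · rw [← setIntegral_eq_integral_of_forall_compl_eq_zero hsupp,
      setIntegral_union hdisj (measurableSet_halfspace _ _) i1 i2, e1, e2]

/-- Continuous functions with a zero of order `m + 1` at the origin and growth of order `m`. -/
structure TaylorBound (m : ℕ) (f : ℝ → ℂ) : Prop where
  cont : Continuous f
  bound : ∃ C, 0 ≤ C ∧ ∀ t, ‖f t‖ ≤ C * |t| ^ m ∧ ‖f t‖ ≤ C * |t| ^ (m + 1)

lemma TaylorBound.zero {m : ℕ} {f : ℝ → ℂ} (hf : TaylorBound m f) : f 0 = 0 := by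
  obtain ⟨C, -, hC⟩ := hf.bound
  simpa using (hC 0).2

lemma TaylorBound.comp_mul {m : ℕ} {f : ℝ → ℂ} (hf : TaylorBound m f) (s : ℝ) :
    TaylorBound m (fun t ↦ f (s * t)) := by
  obtain ⟨C, hC0, hC⟩ := hf.bound
  refine ⟨hf.cont.comp (by fun_prop), C * (|s| ^ m + |s| ^ (m + 1)), by positivity, fun t ↦ ?_⟩
  have h1 := hC (s * t)
  rw [abs_mul, mul_pow, mul_pow] at h1
  have p1 : 0 ≤ C * |s| ^ m * |t| ^ (m + 1) := by positivity
  have p2 : 0 ≤ C * |s| ^ (m + 1) * |t| ^ m := by positivity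
  constructor
  · linarith [h1.1]
  · linarith [h1.2]

/-- Against `t ^ (-β - 1)`, the two bounds leave the exponents `m - β > -1` near zero and `m - β - 1
< -1` at infinity. Both strict inequalities are needed here, hence a non-integer `β`. -/
lemma TaylorBound.integrable {m : ℕ} {f : ℝ → ℂ} (hf : TaylorBound m f) {β : ℝ} (h1 : m < β)
    (h2 : β < m + 1) : Integrable f (paretoTail β) := by
  obtain ⟨C, hC0, hC⟩ := hf.bound
  have hβ : 0 < β := lt_of_le_of_lt (Nat.cast_nonneg m) h1
  have hmeas : Measurable fun t : ℝ ↦ ENNReal.ofReal (β * t ^ (-β - 1)) := by fun_prop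
  rw [paretoTail, integrable_withDensity_iff_integrable_smul' hmeas (by simp)]
  change IntegrableOn _ (Ioi 0) _
  have hsm : AEStronglyMeasurable (fun t : ℝ ↦ (ENNReal.ofReal (β * t ^ (-β - 1))).toReal • f t)
      volume :=
    (hmeas.ennreal_toReal.aestronglyMeasurable).smul hf.cont.aestronglyMeasurable
  have hn : ∀ (k : ℕ) (t : ℝ), 0 < t → ‖f t‖ ≤ C * |t| ^ k →
      ‖(ENNReal.ofReal (β * t ^ (-β - 1))).toReal • f t‖ ≤ β * C * t ^ ((k : ℝ) - β - 1) := by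
    intro k t ht hk
    rw [norm_smul, ENNReal.toReal_ofReal (by positivity), Real.norm_eq_abs,
      abs_of_nonneg (by positivity)]
    calc β * t ^ (-β - 1) * ‖f t‖ ≤ β * t ^ (-β - 1) * (C * |t| ^ k) := by gcongr
      _ = β * C * (t ^ (k : ℝ) * t ^ (-β - 1)) := by
        rw [abs_of_pos ht, Real.rpow_natCast]; ring
      _ = _ := by rw [← Real.rpow_add ht]; ring_nf
  rw [← Ioo_union_Ici_eq_Ioi (zero_lt_one' ℝ)]
  refine IntegrableOn.union ?_ ?_
  · refine Integrable.mono' (g := fun t ↦ β * C * t ^ (((m + 1 : ℕ) : ℝ) - β - 1)) ?_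
      hsm.restrict ?_
    · exact ((intervalIntegral.integrableOn_Ioo_rpow_iff one_pos).2
        (by push_cast; linarith)).const_mul _
    · exact (ae_restrict_iff' measurableSet_Ioo).2 (ae_of_all _ fun t ht ↦
        hn _ t ht.1 (hC t).2)
  · rw [integrableOn_Ici_iff_integrableOn_Ioi]
    refine Integrable.mono' (g := fun t ↦ β * C * t ^ ((m : ℝ) - β - 1)) ?_ hsm.restrict ?_
    · exact (integrableOn_Ioi_rpow_of_lt (by linarith) one_pos).const_mul _
    · exact (ae_restrict_iff' measurableSet_Ioi).2 (ae_of_all _ fun t ht ↦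
        hn _ t (one_pos.trans ht) (hC t).1)

/-- The point `x₀` supplies a unit vector when `ξ = 0`; there is none for `d = 0`. -/
lemma exists_eq_smul_sphere (x₀ ξ : Space d) (hx₀ : x₀ ≠ 0) :
    ∃ (s : ℝ) (ω : UnitSphere d), ξ = s • (ω : Space d) := by
  rcases eq_or_ne ξ 0 with rfl | hξ
  · exact ⟨0, ⟨‖x₀‖⁻¹ • x₀, by simp [norm_smul, hx₀]⟩, by simp⟩
  · exact ⟨‖ξ‖, ⟨‖ξ‖⁻¹ • ξ, by simp [norm_smul, hξ]⟩, by simp [smul_smul, hξ]⟩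

lemma HomTails.integrable_inner {μ : Measure (Punctured d)} {c : UnitSphere d → ℝ≥0∞} {m : ℕ}
    {β : ℝ} (h1 : m < β) (h2 : β < m + 1) (h : HomTails μ c β) {f : ℝ → ℂ} (hf : TaylorBound m f)
    (ξ : Space d) : Integrable (fun x : Punctured d ↦ f (inner ℝ (x : Space d) ξ)) μ := by
  rcases isEmpty_or_nonempty (Punctured d) with hE | ⟨⟨x₀, hx₀⟩⟩
  · rw [Measure.eq_zero_of_isEmpty μ]; exact integrable_zero_measure
  obtain ⟨s, ω, rfl⟩ := exists_eq_smul_sphere x₀ ξ hx₀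
  have hi := (hf.comp_mul s).integrable h1 h2
  have hi' := (hf.comp_mul (-s)).integrable h1 h2
  have := (h.integral_inner (lt_of_le_of_lt (Nat.cast_nonneg m) h1) ω (f := fun t ↦ f (s * t))
    (by simpa using hf.zero) hi (by simpa using hi')).1
  simpa [real_inner_smul_right] using this

lemma HomTails.integral_inner_eq {μ ν : Measure (Punctured d)} {c : UnitSphere d → ℝ≥0∞} {m : ℕ}
    {β : ℝ} (h1 : m < β) (h2 : β < m + 1) (hμ : HomTails μ c β) (hν : HomTails ν c β)
    {f : ℝ → ℂ} (hf : TaylorBound m f) (ξ : Space d) :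
    ∫ x : Punctured d, f (inner ℝ (x : Space d) ξ) ∂μ
      = ∫ x : Punctured d, f (inner ℝ (x : Space d) ξ) ∂ν := by
  rcases isEmpty_or_nonempty (Punctured d) with hE | ⟨⟨x₀, hx₀⟩⟩
  · rw [Measure.eq_zero_of_isEmpty μ, Measure.eq_zero_of_isEmpty ν]
  obtain ⟨s, ω, rfl⟩ := exists_eq_smul_sphere x₀ ξ hx₀
  have hβ : 0 < β := lt_of_le_of_lt (Nat.cast_nonneg m) h1
  have hi := (hf.comp_mul s).integrable h1 h2
  have hi' := (hf.comp_mul (-s)).integrable h1 h2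
  have e1 := (hμ.integral_inner hβ ω (f := fun t ↦ f (s * t))
    (by simpa using hf.zero) hi (by simpa using hi')).2
  have e2 := (hν.integral_inner hβ ω (f := fun t ↦ f (s * t))
    (by simpa using hf.zero) hi (by simpa using hi')).2
  simpa [real_inner_smul_right] using e1.trans e2.symm

/-- The coefficient is taken from `μ` because `a ω (-1)` is the right value only for almost every
`ω`. -/
lemma Represents.homTails {μ : Measure (Punctured d)} {a : UnitSphere d → ℝ → ℝ}
    {β : ℝ} (h : Represents μ a) (ha : HomogeneousInP a (-β)) :
    HomTails μ (fun ω ↦ μ (halfspace ω (-1))) β :=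
  ⟨fun ω ↦ (h.finiteAway.halfspace_lt_top ω (by norm_num)).ne,
    fun ω _ hp ↦ h.halfspace_homogeneous ha ω hp⟩

/-! ### Taylor remainders and finite differences of the exponential. -/

/-- The Taylor polynomial of degree `m` of `z ↦ exp (I * z)` at the origin. -/
def expPoly (m : ℕ) : Polynomial ℂ :=
  ∑ k ∈ Finset.range (m + 1), Polynomial.C (Complex.I ^ k / (k.factorial : ℂ)) * Polynomial.X ^ k

lemma expPoly_eval (m : ℕ) (z : ℂ) :
    (expPoly m).eval z = ∑ k ∈ Finset.range (m + 1), (Complex.I * z) ^ k / (k.factorial : ℂ) := by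
  simp only [expPoly, Polynomial.eval_finsetSum, Polynomial.eval_mul, Polynomial.eval_C,
    Polynomial.eval_pow, Polynomial.eval_X, mul_pow]
  refine Finset.sum_congr rfl fun k _ ↦ by ring

lemma natDegree_expPoly_le (m : ℕ) : (expPoly m).natDegree ≤ m :=
  Polynomial.natDegree_sum_le_of_forall_le _ _ fun _ hk ↦
    (Polynomial.natDegree_C_mul_X_pow_le _ _).trans (Nat.lt_succ_iff.1 (Finset.mem_range.1 hk))

/-- The remainder in the Taylor expansion of degree `m` of `t ↦ exp (I * t)`. -/
def expRem (m : ℕ) (t : ℝ) : ℂ := Complex.exp (Complex.I * t) - (expPoly m).eval (t : ℂ)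

lemma taylorBound_expRem (m : ℕ) : TaylorBound m (expRem m) := by
  -- The term `exp 1` serves `|t| ≤ 1`. For `|t| ≥ 1`, the exponential and the `m + 1` Taylor terms
  -- are each at most `|t| ^ m`, whence `m + 2`.
  refine ⟨by unfold expRem; fun_prop, Real.exp 1 + (m + 2), by positivity, fun t ↦ ?_⟩
  have hp : (0 : ℝ) < Real.exp 1 := Real.exp_pos 1
  rcases le_total |t| 1 with ht | ht
  · have h1 : ‖expRem m t‖ ≤ |t| ^ (m + 1) * Real.exp 1 := by
      rw [expRem, expPoly_eval]
      refine (Complex.norm_exp_sub_sum_le_norm_mul_exp _ _).trans ?_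
      simp only [norm_mul, Complex.norm_I, one_mul, Complex.norm_real, Real.norm_eq_abs]
      gcongr
    have h2 : |t| ^ (m + 1) ≤ |t| ^ m := pow_le_pow_of_le_one (abs_nonneg t) ht (Nat.le_succ m)
    have h3 : 0 ≤ |t| ^ (m + 1) := by positivity
    have h4 : ‖expRem m t‖ ≤ (Real.exp 1 + (m + 2)) * |t| ^ (m + 1) := by
      have : 0 ≤ ((m : ℝ) + 2) * |t| ^ (m + 1) := by positivity
      linarith
    exact ⟨h4.trans (by gcongr), h4⟩
  · have h2 : |t| ^ m ≤ |t| ^ (m + 1) := pow_le_pow_right₀ ht (Nat.le_succ m)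
    have h1 : ‖expRem m t‖ ≤ (m + 2) * |t| ^ m := by
      rw [expRem, expPoly_eval]
      have e1 : ‖Complex.exp (Complex.I * t)‖ = 1 := by
        rw [mul_comm]; exact Complex.norm_exp_ofReal_mul_I t
      have e2 : ‖∑ k ∈ Finset.range (m + 1), (Complex.I * (t : ℂ)) ^ k / (k.factorial : ℂ)‖
          ≤ ∑ k ∈ Finset.range (m + 1), |t| ^ m := by
        refine norm_sum_le_of_le _ fun k hk ↦ ?_
        rw [norm_div, norm_pow, norm_mul, Complex.norm_I, one_mul, Complex.norm_real,
          Real.norm_eq_abs, Complex.norm_natCast]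
        refine (div_le_self (by positivity) ?_).trans
          (pow_le_pow_right₀ ht (Nat.lt_succ_iff.1 (Finset.mem_range.1 hk)))
        exact_mod_cast Nat.one_le_iff_ne_zero.2 k.factorial_ne_zero
      rw [Finset.sum_const, Finset.card_range, nsmul_eq_mul] at e2
      have e3 : 1 ≤ |t| ^ m := one_le_pow₀ ht
      refine (norm_sub_le _ _).trans ?_
      rw [e1]
      push_cast at e2
      linarith
    have h4 : ‖expRem m t‖ ≤ (Real.exp 1 + (m + 2)) * |t| ^ m := by
      have : 0 ≤ Real.exp 1 * |t| ^ m := by positivity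
      linarith
    exact ⟨h4, h4.trans (by gcongr)⟩

/-- The sum is an `n`-th forward difference, which annihilates polynomials of degree less than `n`.
-/
lemma sum_alternating_eval_eq_zero {P : Polynomial ℂ} {n : ℕ} (hP : P.natDegree < n) (a b : ℂ) :
    ∑ k ∈ Finset.range (n + 1), ((-1 : ℂ) ^ (n - k) * n.choose k) * P.eval (a + k * b) = 0 := by
  set Q := P.comp (Polynomial.C a + Polynomial.C b * Polynomial.X) with hQ
  have hdeg : Q.natDegree < n := by
    have hq : (Polynomial.C a + Polynomial.C b * Polynomial.X).natDegree ≤ 1 := by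
      compute_degree
    exact lt_of_le_of_lt (Polynomial.natDegree_comp_le.trans
      ((Nat.mul_le_mul_left _ hq).trans_eq (mul_one _))) hP
  have h1 := congrFun (Polynomial.fwdDiff_iter_eq_zero_of_degree_lt hdeg) 0
  rw [fwdDiff_iter_eq_sum_shift] at h1
  rw [Pi.zero_apply] at h1
  rw [← h1]
  refine Finset.sum_congr rfl fun k _ ↦ ?_
  rw [hQ, zsmul_eq_mul, Polynomial.eval_comp]
  simp only [Polynomial.eval_add, Polynomial.eval_mul, Polynomial.eval_C, Polynomial.eval_X]
  push_cast
  rw [nsmul_eq_mul, zero_add, mul_one, mul_comm b]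

lemma exp_mul_pow_eq_sum_expRem {m n : ℕ} (hmn : m < n) (a b : ℝ) :
    Complex.exp (Complex.I * a) * (Complex.exp (Complex.I * b) - 1) ^ n
      = ∑ k ∈ Finset.range (n + 1), ((-1 : ℂ) ^ (n - k) * n.choose k) * expRem m (a + k * b) := by
  have h := sum_alternating_eval_eq_zero
    (lt_of_le_of_lt (natDegree_expPoly_le m) hmn) (a : ℂ) (b : ℂ)
  simp only [expRem, mul_sub, Finset.sum_sub_distrib]
  push_cast
  rw [h, sub_zero, sub_eq_add_neg, add_pow, Finset.mul_sum]
  refine Finset.sum_congr rfl fun k _ ↦ ?_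
  rw [mul_add, Complex.exp_add, ← Complex.exp_nat_mul]
  ring_nf

/-- The weight `|exp (I * t) - 1| ^ (2 n)`. -/
def expWeight (n : ℕ) (t : ℝ) : ℝ := ‖Complex.exp (Complex.I * t) - 1‖ ^ (2 * n)

/-- With `z = exp (I t)`, conjugation gives `|z - 1| ^ 2 = -z⁻¹ (z - 1) ^ 2`. The weight is thus, up
to sign and phase, a power to which the difference formula applies. -/
lemma expWeight_eq (n : ℕ) (t : ℝ) : (expWeight n t : ℂ)
    = (-1) ^ n * (Complex.exp (Complex.I * (-(n * t) : ℝ))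
      * (Complex.exp (Complex.I * t) - 1) ^ (2 * n)) := by
  have h1 : (starRingEnd ℂ) (Complex.exp (Complex.I * t) - 1)
      = - (Complex.exp (Complex.I * (-t : ℝ)) * (Complex.exp (Complex.I * t) - 1)) := by
    rw [map_sub, ← Complex.exp_conj, mul_sub, ← Complex.exp_add]
    simp
  rw [expWeight, pow_mul, Complex.ofReal_pow, ← Complex.normSq_eq_norm_sq,
    Complex.normSq_eq_conj_mul_self, h1, pow_mul, sq, ← neg_one_mul, mul_pow, mul_pow, mul_pow,
    mul_pow, ← Complex.exp_nat_mul]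
  push_cast
  ring_nf

lemma taylorBound_expWeight (m : ℕ) : TaylorBound m (fun t ↦ (expWeight (m + 1) t : ℂ)) := by
  refine ⟨by unfold expWeight; fun_prop, 2 ^ (2 * (m + 1)), by positivity, fun t ↦ ?_⟩
  rw [Complex.norm_real, Real.norm_eq_abs, abs_of_nonneg (by unfold expWeight; positivity)]
  have h1 : ‖Complex.exp (Complex.I * t) - 1‖ ≤ |t| := Real.norm_exp_I_mul_ofReal_sub_one_le
  have h2 : ‖Complex.exp (Complex.I * t) - 1‖ ≤ 2 := by
    refine (norm_sub_le _ _).trans ?_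
    rw [mul_comm, Complex.norm_exp_ofReal_mul_I, norm_one]
    norm_num
  have hone : (1 : ℝ) ≤ 2 ^ (2 * (m + 1)) := one_le_pow₀ (by norm_num)
  rcases le_total |t| 1 with ht | ht
  · have hb : ∀ k ≤ m + 1, expWeight (m + 1) t ≤ 2 ^ (2 * (m + 1)) * |t| ^ k := by
      intro k hk
      calc expWeight (m + 1) t ≤ |t| ^ (2 * (m + 1)) := by unfold expWeight; gcongr
        _ ≤ |t| ^ k := pow_le_pow_of_le_one (abs_nonneg t) ht (by omega)
        _ ≤ _ := le_mul_of_one_le_left (by positivity) hone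
    exact ⟨hb _ (by omega), hb _ le_rfl⟩
  · have hb : ∀ k, expWeight (m + 1) t ≤ 2 ^ (2 * (m + 1)) * |t| ^ k := by
      intro k
      calc expWeight (m + 1) t ≤ 2 ^ (2 * (m + 1)) := by unfold expWeight; gcongr
        _ ≤ _ := le_mul_of_one_le_right (by positivity) (one_le_pow₀ ht)
    exact ⟨hb _, hb _⟩

/-- The phase of the weight centres the difference of order `2 (m + 1)`, hence the shift by `-(m +
1) * b`. -/
lemma exp_mul_expWeight {m : ℕ} (a b : ℝ) :
    Complex.exp (Complex.I * a) * expWeight (m + 1) b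
      = ∑ k ∈ Finset.range (2 * (m + 1) + 1), ((-1) ^ (m + 1) *
        ((-1 : ℂ) ^ (2 * (m + 1) - k) * (2 * (m + 1)).choose k)) *
          expRem m (a - (m + 1) * b + k * b) := by
  simp_rw [mul_assoc ((-1 : ℂ) ^ (m + 1))]
  have h : Complex.exp (Complex.I * (a - (m + 1) * b : ℝ))
      = Complex.exp (Complex.I * a) * Complex.exp (Complex.I * (-((m + 1 : ℕ) * b) : ℝ)) := by
    rw [← Complex.exp_add]
    push_cast
    ring_nf
  rw [← Finset.mul_sum, ← exp_mul_pow_eq_sum_expRem (by omega), expWeight_eq, h]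
  ring

/-! ### Fourier uniqueness for weighted measures. -/

section Uniqueness

variable {μ ν : Measure (Punctured d)} {c : UnitSphere d → ℝ≥0∞} {m : ℕ} {β : ℝ}

lemma HomTails.integral_exp_mul_weight_eq (h1 : m < β) (h2 : β < m + 1) (hμ : HomTails μ c β)
    (hν : HomTails ν c β) (ξ h : Space d) :
    ∫ x : Punctured d, Complex.exp (Complex.I * (inner ℝ (x : Space d) ξ : ℝ))
        * expWeight (m + 1) (inner ℝ (x : Space d) h) ∂μ
      = ∫ x : Punctured d, Complex.exp (Complex.I * (inner ℝ (x : Space d) ξ : ℝ))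
        * expWeight (m + 1) (inner ℝ (x : Space d) h) ∂ν := by
  have hin : ∀ (x : Punctured d) (k : ℕ), inner ℝ (x : Space d) ξ
      - (m + 1) * inner ℝ (x : Space d) h + k * inner ℝ (x : Space d) h
      = inner ℝ (x : Space d) (ξ - ((m : ℝ) + 1) • h + (k : ℝ) • h) := by
    intro x k
    simp only [inner_add_right, inner_sub_right, real_inner_smul_right]
  simp only [exp_mul_expWeight, hin]
  rw [integral_finsetSum, integral_finsetSum]
  · refine Finset.sum_congr rfl fun k _ ↦ ?_
    rw [integral_const_mul, integral_const_mul,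
      hμ.integral_inner_eq h1 h2 hν (taylorBound_expRem m)]
  · exact fun k _ ↦ (hν.integrable_inner h1 h2 (taylorBound_expRem m) _).const_mul _
  · exact fun k _ ↦ (hμ.integrable_inner h1 h2 (taylorBound_expRem m) _).const_mul _

/-- The density `x ↦ |exp (I * x · h) - 1| ^ (2 (m + 1))`. -/
def weightDensity (m : ℕ) (h : Space d) (x : Punctured d) : ℝ≥0∞ :=
  ENNReal.ofReal (expWeight (m + 1) (inner ℝ (x : Space d) h))

lemma measurable_weightDensity (m : ℕ) (h : Space d) : Measurable (weightDensity m h) := by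
  unfold weightDensity expWeight; fun_prop

lemma HomTails.isFiniteMeasure_withDensity (h1 : m < β) (h2 : β < m + 1) (hμ : HomTails μ c β)
    (h : Space d) : IsFiniteMeasure (μ.withDensity (weightDensity m h)) := by
  have hi := hμ.integrable_inner h1 h2 (taylorBound_expWeight m) h
  have hr : Integrable (fun x : Punctured d ↦ expWeight (m + 1) (inner ℝ (x : Space d) h)) μ :=
    by simpa using hi.re
  exact isFiniteMeasure_withDensity_ofReal hr.2

lemma charFun_map_withDensity (m : ℕ) (h ξ : Space d) :
    charFun ((μ.withDensity (weightDensity m h)).map (fun x : Punctured d ↦ (x : Space d))) ξ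
      = ∫ x : Punctured d, Complex.exp (Complex.I * (inner ℝ (x : Space d) ξ : ℝ))
        * expWeight (m + 1) (inner ℝ (x : Space d) h) ∂μ := by
  rw [charFun_apply, integral_map (by fun_prop) (by fun_prop),
    integral_withDensity_eq_integral_toReal_smul (measurable_weightDensity m h)
      (ae_of_all _ fun x ↦ ENNReal.ofReal_lt_top)]
  refine integral_congr_ae (ae_of_all _ fun x ↦ ?_)
  have : 0 ≤ expWeight (m + 1) (inner ℝ (x : Space d) h) := by unfold expWeight; positivity
  simp only [weightDensity, ENNReal.toReal_ofReal this, Complex.real_smul]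
  ring_nf

lemma HomTails.withDensity_eq (h1 : m < β) (h2 : β < m + 1) (hμ : HomTails μ c β)
    (hν : HomTails ν c β) (h : Space d) :
    μ.withDensity (weightDensity m h) = ν.withDensity (weightDensity m h) := by
  have := hμ.isFiniteMeasure_withDensity h1 h2 h
  have := hν.isFiniteMeasure_withDensity h1 h2 h
  have hemb : MeasurableEmbedding (fun x : Punctured d ↦ (x : Space d)) :=
    MeasurableEmbedding.subtype_coe (measurableSet_singleton (0 : Space d)).compl
  refine hemb.map_injective (Measure.ext_of_charFun (funext fun ξ ↦ ?_))
  rw [charFun_map_withDensity, charFun_map_withDensity]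
  exact hμ.integral_exp_mul_weight_eq h1 h2 hν ξ h

lemma restrict_eq_of_withDensity_eq {α : Type*} [MeasurableSpace α] {μ ν : Measure α}
    {f : α → ℝ≥0∞} (hf : Measurable f) (htop : ∀ x, f x ≠ ⊤)
    (h : μ.withDensity f = ν.withDensity f) :
    μ.restrict {x | f x ≠ 0} = ν.restrict {x | f x ≠ 0} := by
  have hs : MeasurableSet {x | f x ≠ 0} := hf (measurableSet_singleton 0).compl
  have key : ∀ ρ : Measure α, ((ρ.withDensity f).restrict {x | f x ≠ 0}).withDensity
      (fun x ↦ (f x)⁻¹) = ρ.restrict {x | f x ≠ 0} := by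
    intro ρ
    rw [restrict_withDensity hs]
    exact withDensity_inv_same hf ((ae_restrict_iff' hs).2 (ae_of_all _ fun x hx ↦ hx))
      (ae_of_all _ htop)
  rw [← key μ, ← key ν, h]

/-- A measure with tails homogeneous of non-integer degree is determined by them. -/
theorem HomTails.measure_eq (h1 : m < β) (h2 : β < m + 1) (hμ : HomTails μ c β)
    (hν : HomTails ν c β) : μ = ν := by
  -- This choice gives `y · g y = 1`, where the weight is positive because `sin 1 ≠ 0`. Countably
  -- many of the sets `S y` then cover the space.
  set g : Punctured d → Space d := fun x ↦ (‖(x : Space d)‖ ^ 2)⁻¹ • (x : Space d)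
  set S : Punctured d → Set (Punctured d) := fun y ↦ {x | weightDensity m (g y) x ≠ 0}
  have hS : ∀ y, S y ∈ 𝓝 y := by
    intro y
    have ho : IsOpen (S y) := by
      have : Continuous (weightDensity m (g y)) := 
        by unfold weightDensity expWeight; exact ENNReal.continuous_ofReal.comp (by fun_prop)
      exact isOpen_ne_fun this continuous_const
    refine ho.mem_nhds ?_
    have hy : inner ℝ (y : Space d) (g y) = 1 := by
      simp only [g, real_inner_smul_right, real_inner_self_eq_norm_sq]
      exact inv_mul_cancel₀ (pow_ne_zero 2 (norm_ne_zero_iff.2 y.2))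
    simp only [S, mem_ofPred_eq, weightDensity, hy, expWeight]
    rw [ne_eq, ENNReal.ofReal_eq_zero, not_le]
    refine pow_pos (norm_pos_iff.2 ?_) _
    intro h0
    have := congrArg Complex.im h0
    rw [mul_comm] at this
    simp only [Complex.sub_im, Complex.exp_ofReal_mul_I_im, Complex.one_im, sub_zero,
      Complex.zero_im] at this
    have hsin : 0 < Real.sin 1 := Real.sin_pos_of_pos_of_lt_pi one_pos (by linarith [Real.pi_gt_three])
    exact hsin.ne' this
  obtain ⟨s, hs, hU⟩ := TopologicalSpace.countable_cover_nhds hS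
  have := (Measure.restrict_biUnion_congr (μ := μ) (ν := ν) hs).2 fun y _ ↦
    restrict_eq_of_withDensity_eq (measurable_weightDensity m (g y))
      (fun x ↦ ENNReal.ofReal_ne_top) (hμ.withDensity_eq h1 h2 hν (g y))
  rwa [hU, Measure.restrict_univ, Measure.restrict_univ] at this

end Uniqueness

/-! ### Uniqueness and homogeneity of `μ`. -/

lemma Represents.unique {μ ν : Measure (Punctured d)} {a : UnitSphere d → ℝ → ℝ} {β : ℝ}
    (hβ : 0 < β) (hβ_int : ∀ n : ℤ, β ≠ (n : ℝ)) (ha : HomogeneousInP a (-β))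
    (hμ : Represents μ a) (hν : Represents ν a) : μ = ν := by
  have h1 : (⌊β⌋₊ : ℝ) < β := lt_of_le_of_ne (Nat.floor_le hβ.le)
    fun h ↦ hβ_int ⌊β⌋₊ (by rw [Int.cast_natCast]; exact h.symm)
  have hν' := hν.homTails ha
  simp_rw [← fun ω ↦ hμ.measure_halfspace_eq hν ha ω (-1) (by norm_num)] at hν'
  exact (hμ.homTails ha).measure_eq h1 (Nat.lt_floor_add_one β) hν'

lemma Represents.homogeneousMeasure {μ : Measure (Punctured d)} {a : UnitSphere d → ℝ → ℝ} {β : ℝ}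
    (hβ : 0 < β) (hβ_int : ∀ n : ℤ, β ≠ (n : ℝ)) (ha : HomogeneousInP a (-β))
    (hμ : Represents μ a) : HomogeneousMeasure μ (-(d : ℝ) - β) := by
  intro φ hφ _ _ r hr
  have hr' : 0 < r⁻¹ := inv_pos.2 hr
  have h1 := Represents.unique hβ hβ_int ha hμ (hμ.rescale ha r⁻¹ hr')
  have h2 : ∫ x, φ (x : Space d) ∂μ
      = r ^ β * ∫ x : Punctured d, φ (r⁻¹ • (x : Space d)) ∂μ := by
    conv_lhs => rw [h1]
    rw [CramerWold.rescale, integral_smul_measure, integral_map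
      (continuous_dilation r⁻¹ hr').aemeasurable
      (f := fun x : Punctured d ↦ φ (x : Space d))
      (hφ.continuous.comp continuous_subtype_val).aestronglyMeasurable,
      ENNReal.toReal_ofReal (by positivity), Real.inv_rpow hr.le, Real.rpow_neg hr.le, inv_inv]
    rfl
  rw [h2, ← mul_assoc, ← Real.rpow_add hr]
  ring_nf
  simp

/-! ### The Radon transform. -/

lemma extendZero_of_neg (ψ : NegTest d) (ω : UnitSphere d) {p : ℝ} (hp : p < 0) :
    extendZero ψ ω p = ψ (ω, ⟨p, hp⟩) := dif_pos hp

lemma extendZero_of_nonneg (ψ : NegTest d) (ω : UnitSphere d) {p : ℝ} (hp : ¬ p < 0) :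
    extendZero ψ ω p = 0 := dif_neg hp

lemma measurable_extendZero (ψ : NegTest d) :
    Measurable fun z : UnitSphere d × ℝ ↦ extendZero ψ z.1 z.2 := by
  classical
  have hs : MeasurableSet {z : UnitSphere d × ℝ | z.2 < 0} :=
    measurableSet_lt measurable_snd measurable_const
  have hf : Measurable fun z : {z : UnitSphere d × ℝ | z.2 < 0} ↦
      ψ (z.1.1, ⟨z.1.2, z.2⟩) :=
    (ψ.continuous.comp (by fun_prop)).measurable
  exact Measurable.dite hf (g := fun _ ↦ 0) measurable_const hs

lemma exists_extendZero_bound (ψ : NegTest d) :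
    ∃ δ K M : ℝ, 0 < δ ∧ 0 ≤ M ∧ ∀ ω p, |extendZero ψ ω p| ≤ M ∧
      (extendZero ψ ω p ≠ 0 → p ∈ Icc (-K) (-δ)) := by
  have hcomp : IsCompact (tsupport ψ) := ψ.hasCompactSupport
  obtain ⟨M, hM⟩ := hcomp.exists_bound_of_continuousOn ψ.continuous.continuousOn
  have hM' : ∀ z, |ψ z| ≤ max M 0 := fun z ↦ by
    by_cases hz : z ∈ tsupport ψ
    · exact (hM z hz).trans (le_max_left _ _)
    · rw [image_eq_zero_of_notMem_tsupport hz]; simp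
  have hc : Continuous fun z : UnitSphere d × Iio (0 : ℝ) ↦ (z.2 : ℝ) := by fun_prop
  obtain ⟨L, hL⟩ := (hcomp.image hc).bddBelow
  obtain ⟨δ, hδ, hδ'⟩ : ∃ δ : ℝ, 0 < δ ∧ ∀ z ∈ tsupport ψ, (z.2 : ℝ) ≤ -δ := by
    rcases (tsupport ψ).eq_empty_or_nonempty with h | h
    · exact ⟨1, one_pos, by simp [h]⟩
    · obtain ⟨z, -, hz⟩ := hcomp.exists_isMaxOn h hc.continuousOn
      exact ⟨-z.2, neg_pos.2 z.2.2, fun y hy ↦ by simpa using hz hy⟩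
  refine ⟨δ, -L, max M 0, hδ, le_max_right _ _, fun ω p ↦ ?_⟩
  by_cases hp : p < 0
  · rw [extendZero_of_neg ψ ω hp]
    refine ⟨hM' _, fun h ↦ ?_⟩
    have hz : (ω, (⟨p, hp⟩ : Iio (0 : ℝ))) ∈ tsupport ψ := subset_tsupport _ h
    exact ⟨by rw [neg_neg]; exact hL (mem_image_of_mem _ hz), hδ' _ hz⟩
  · rw [extendZero_of_nonneg ψ ω hp]
    simp

lemma FiniteAway.sigmaFinite {μ : Measure (Punctured d)} (h : FiniteAway μ) : SigmaFinite μ := by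
  refine ⟨⟨⟨fun n ↦ {x | (1 / (n + 1 : ℝ)) ≤ ‖(x : Space d)‖}, fun _ ↦ mem_univ _,
    fun n ↦ h _ (by positivity), ?_⟩⟩⟩
  rw [eq_univ_iff_forall]
  intro x
  obtain ⟨n, hn⟩ := exists_nat_one_div_lt (norm_pos_iff.2 x.2)
  exact mem_iUnion.2 ⟨n, hn.le⟩

/-- Since `|x · ω| ≤ ‖x‖`, a test function supported in `p ≤ -δ` only sees `‖x‖ ≥ δ`, a set of
finite mass. -/
lemma integrable_extendZero_inner {μ : Measure (Punctured d)} (h : FiniteAway μ) (ψ : NegTest d) :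
    Integrable (fun z : Punctured d × UnitSphere d ↦
      extendZero ψ z.2 (inner ℝ (z.1 : Space d) (z.2 : Space d)))
      (μ.prod (sphereMeasure d)) := by
  have := h.sigmaFinite
  obtain ⟨δ, K, M, hδ, hM, hψ⟩ := exists_extendZero_bound ψ
  set A : Set (Punctured d) := {x | δ ≤ ‖(x : Space d)‖}
  have hA : MeasurableSet A := (isClosed_le continuous_const (by fun_prop)).measurableSet
  have hint : Integrable (A.indicator fun _ ↦ M) μ :=
    (integrable_indicator_iff hA).2 (integrableOn_const (h δ hδ).ne)
  refine (hint.comp_fst (sphereMeasure d)).mono' ?_ (ae_of_all _ fun z ↦ ?_)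
  · exact ((measurable_extendZero ψ).comp
      (f := fun z : Punctured d × UnitSphere d ↦ (z.2, inner ℝ (z.1 : Space d) (z.2 : Space d)))
      (by fun_prop)).aestronglyMeasurable
  · rw [Real.norm_eq_abs]
    obtain ⟨h1, h2⟩ := hψ z.2 (inner ℝ (z.1 : Space d) (z.2 : Space d))
    by_cases hz : z.1 ∈ A
    · rwa [indicator_of_mem hz]
    · rw [indicator_of_notMem hz]
      by_contra hne
      have hp := (h2 fun h0 ↦ hne (by rw [h0, abs_zero])).2
      have hn := abs_real_inner_le_norm (z.1 : Space d) (z.2 : Space d)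
      have hω : ‖(z.2 : Space d)‖ = 1 := by simp
      rw [hω, mul_one] at hn
      exact hz (by
        change δ ≤ ‖(z.1 : Space d)‖
        linarith [neg_abs_le (inner ℝ (z.1 : Space d) (z.2 : Space d))])

lemma integral_paretoTail {β : ℝ} (hβ : 0 < β) (g : ℝ → ℝ) :
    ∫ t, g (-t) ∂(paretoTail β) = ∫ p in Iio (0 : ℝ), β * (-p) ^ (-β - 1) * g p := by
  rw [paretoTail, integral_withDensity_eq_integral_toReal_smul (by fun_prop) (by simp),
    ← integral_Iic_eq_integral_Iio, ← neg_zero, ← integral_comp_neg_Ioi, neg_zero]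
  refine setIntegral_congr_fun measurableSet_Ioi fun t ht ↦ ?_
  have ht : 0 < t := ht
  simp only [smul_eq_mul, neg_neg]
  rw [ENNReal.toReal_ofReal (by positivity)]

lemma HomTails.integral_extendZero_inner {μ : Measure (Punctured d)} {c : UnitSphere d → ℝ≥0∞}
    {β : ℝ} (hβ : 0 < β) (h : HomTails μ c β) (ψ : NegTest d) (ω : UnitSphere d) :
    ∫ x : Punctured d, extendZero ψ ω (inner ℝ (x : Space d) (ω : Space d)) ∂μ
      = (c ω).toReal * ∫ p in Iio (0 : ℝ), β * (-p) ^ (-β - 1) * extendZero ψ ω p := by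
  have hm : Measurable (extendZero ψ ω) :=
    (measurable_extendZero ψ).comp (measurable_prodMk_left (x := ω))
  rw [← integral_paretoTail hβ, ← smul_eq_mul,
    ← h.setIntegral_halfspace hβ ω (hm.comp measurable_neg).aestronglyMeasurable]
  exact (setIntegral_eq_integral_of_forall_compl_eq_zero
    fun x hx ↦ extendZero_of_nonneg ψ ω hx).symm

lemma HomogeneousInP.hasDerivAt {a : UnitSphere d → ℝ → ℝ} {β : ℝ} (ha : HomogeneousInP a (-β))
    (ω : UnitSphere d) {p : ℝ} (hp : p < 0) :
    HasDerivAt (a ω) (a ω (-1) * (β * (-p) ^ (-β - 1))) p := by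
  have h1 : HasDerivAt (fun q : ℝ ↦ a ω (-1) * (-q) ^ (-β))
      (a ω (-1) * (β * (-p) ^ (-β - 1))) p := by
    convert! (((hasDerivAt_id p).neg).rpow_const (p := -β)
      (Or.inl (neg_ne_zero.2 hp.ne))).const_mul (a ω (-1)) using 2
    simp
  refine h1.congr_of_eventuallyEq ?_
  filter_upwards [Iio_mem_nhds hp] with q hq
  exact ha.eq_mul ω hq

lemma measurable_measureReal_halfspace (μ : Measure (Punctured d)) [SFinite μ] (p : ℝ) :
    Measurable fun ω : UnitSphere d ↦ μ.real (halfspace ω p) := by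
  have hs : MeasurableSet {z : UnitSphere d × Punctured d |
      inner ℝ (z.2 : Space d) (z.1 : Space d) < p} :=
    measurableSet_lt (by fun_prop) measurable_const
  exact (measurable_measure_prodMk_left (ν := μ) hs).ennreal_toReal

lemma Represents.ae_deriv {μ : Measure (Punctured d)} {a : UnitSphere d → ℝ → ℝ} {β : ℝ}
    (h : Represents μ a) (ha : HomogeneousInP a (-β)) :
    ∀ᵐ ω ∂(sphereMeasure d), ∀ p < 0,
      deriv (a ω) p = μ.real (halfspace ω (-1)) * (β * (-p) ^ (-β - 1)) := by
  filter_upwards [h.ae_forall ha] with ω hω p hp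
  rw [(ha.hasDerivAt ω hp).deriv, hω (-1) (by norm_num)]

lemma Represents.integrable_deriv_mul {μ : Measure (Punctured d)} {a : UnitSphere d → ℝ → ℝ}
    {β : ℝ} (hβ : 0 < β) (h : Represents μ a) (ha : HomogeneousInP a (-β)) (ψ : NegTest d) :
    Integrable (fun z : UnitSphere d × ℝ ↦ deriv (a z.1) z.2 * extendZero ψ z.1 z.2)
      (negMeasure d) := by
  have := h.finiteAway.sigmaFinite
  obtain ⟨δ, K, M, hδ, hM, hψ⟩ := exists_extendZero_bound ψ
  -- No measurability of `a` in `ω` is given; it is obtained from the sections of `μ`.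
  have hae : (fun z : UnitSphere d × ℝ ↦ μ.real (halfspace z.1 (-1)) * (β * (-z.2) ^ (-β - 1))
      * extendZero ψ z.1 z.2)
      =ᵐ[negMeasure d] fun z ↦ deriv (a z.1) z.2 * extendZero ψ z.1 z.2 := by
    have h1 := (Measure.quasiMeasurePreserving_fst (μ := sphereMeasure d)
      (ν := volume.restrict (Iio (0 : ℝ)))).ae (h.ae_deriv ha)
    filter_upwards [h1] with z hz
    by_cases hp : z.2 < 0
    · rw [hz _ hp]
    · rw [extendZero_of_nonneg ψ _ hp, mul_zero, mul_zero]
  refine Integrable.congr ?_ hae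
  set C := μ.real {x : Punctured d | 1 ≤ ‖(x : Space d)‖}
  set B : Set (UnitSphere d × ℝ) := univ ×ˢ Icc (-K) (-δ)
  have hB : MeasurableSet B := MeasurableSet.univ.prod measurableSet_Icc
  have hBfin : negMeasure d B ≠ ⊤ := by
    rw [negMeasure, Measure.prod_prod]
    exact ENNReal.mul_ne_top (measure_ne_top _ _)
      ((Measure.restrict_apply_le _ _).trans_lt measure_Icc_lt_top).ne
  have hint : Integrable (B.indicator fun _ ↦ C * (β * δ ^ (-β - 1)) * M) (negMeasure d) :=
    (integrable_indicator_iff hB).2 (integrableOn_const hBfin)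
  refine hint.mono' ?_ (ae_of_all _ fun z ↦ ?_)
  · have h1 : Measurable fun z : UnitSphere d × ℝ ↦ μ.real (halfspace z.1 (-1)) :=
      (measurable_measureReal_halfspace μ (-1)).comp measurable_fst
    have h2 : Measurable fun z : UnitSphere d × ℝ ↦ β * (-z.2) ^ (-β - 1) := by fun_prop
    exact ((h1.mul h2).mul (measurable_extendZero ψ)).aestronglyMeasurable
  · obtain ⟨h1, h2⟩ := hψ z.1 z.2
    by_cases h0 : extendZero ψ z.1 z.2 = 0
    · rw [h0, mul_zero, norm_zero]
      exact indicator_nonneg (fun _ _ ↦ by positivity) z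
    · have hz := h2 h0
      have hzp : δ ≤ -z.2 := by linarith [hz.2]
      have hz0 : 0 < -z.2 := hδ.trans_le hzp
      rw [indicator_of_mem (show z ∈ B from ⟨mem_univ _, hz⟩), norm_mul, Real.norm_eq_abs,
        Real.norm_eq_abs, abs_of_nonneg (by positivity)]
      have hC : μ.real (halfspace z.1 (-1)) ≤ C :=
        measureReal_mono (fun x hx ↦ by simpa using (norm_gt_of_mem_halfspace hx).le)
          (h.finiteAway 1 one_pos).ne
      have hpow : (-z.2) ^ (-β - 1) ≤ δ ^ (-β - 1) :=
        Real.rpow_le_rpow_of_nonpos hδ hzp (by linarith)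
      gcongr

/-- After Fubini, the integral over `x` for fixed `ω` is against `μ.real (halfspace ω (-1)) * (β *
(-p) ^ (-β - 1))`, which is `deriv (a ω) p` for almost every `ω`. -/
lemma Represents.radonEqDerivP {μ : Measure (Punctured d)} {a : UnitSphere d → ℝ → ℝ} {β : ℝ}
    (hβ : 0 < β) (h : Represents μ a) (ha : HomogeneousInP a (-β)) : RadonEqDerivP μ a := by
  have := h.finiteAway.sigmaFinite
  refine ⟨fun ω p hp ↦ (ha.hasDerivAt ω hp).differentiableAt, fun ψ ↦ ?_⟩
  have hF := integrable_extendZero_inner h.finiteAway ψ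
  have hG := h.integrable_deriv_mul hβ ha ψ
  refine ⟨hF.integral_prod_left, hG, ?_⟩
  rw [negMeasure] at hG ⊢
  rw [integral_prod _ hG]
  calc radonTransform μ ψ
      = ∫ ω, ∫ x : Punctured d, extendZero ψ ω (inner ℝ (x : Space d) (ω : Space d)) ∂μ
          ∂(sphereMeasure d) := integral_integral_swap hF
    _ = _ := ?_
  refine integral_congr_ae ?_
  filter_upwards [h.ae_deriv ha] with ω hω
  rw [(h.homTails ha).integral_extendZero_inner hβ, ← integral_const_mul]
  refine setIntegral_congr_fun measurableSet_Iio fun p hp ↦ ?_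
  simp only [hω p hp, measureReal_def, mul_assoc]

end CramerWold

end

theorem mainTheorem4 (d : ℕ) (β : ℝ) (hβ : 0 < β) (hβ_int : ∀ n : ℤ, β ≠ (n : ℝ))
    (a : UnitSphere d → ℝ → ℝ) (ha_bdd : LocallyBoundedNeg a) (ha_hom : HomogeneousInP a (-β)) :
    (∀ μ ν : Measure (Punctured d), Represents μ a → Represents ν a → μ = ν) ∧
    (∀ μ : Measure (Punctured d), Represents μ a →
      HomogeneousMeasure μ (-(d : ℝ) - β) ∧ RadonEqDerivP μ a) :=
  ⟨fun _ _ hμ hν ↦ hμ.unique hβ hβ_int ha_hom hν,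
    fun _ hμ ↦ ⟨hμ.homogeneousMeasure hβ hβ_int ha_hom, hμ.radonEqDerivP hβ ha_hom⟩⟩
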